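/- For graphs $F,G,H$ write $F\longrightarrow(G,H)$ if every red-blue colouring of the edges of $F$ contains a red copy of $G$ or a blue copy of $H$ (as a subgraph, not necessarily induced). The Ramsey number $r(G,H)$ is the least $N$ with $K_N\longrightarrow(G,H)$. For finite graphs $F$, let $$\hat r(G,H)=\min\{|E(F)| : F\longrightarrow(G,H)\},\qquad \hat r^{*}(G,H)=\min\{|E(F)| : F\longrightarrow(G,H),\ |V(F)|=r(G,H)\}$$ be the size Ramsey number and the restricted size Ramsey number. Let $K_{1,k}$ be the star with $k$ edges and $K_n$ the complete graph on $n$ vertices. **Theorem.** Let $k\ge 2$ and $n\ge k^{3}+2k^{2}+2k$ be integers. Then $$\hat r(K_{1,k},K_n)=\hat r^{*}(K_{1,k},K_n)=\begin{cases}\binom{k(n-1)+1}{2}-\binom{k}{2} & \text{if } k \text{ is odd},\\[4pt] \binom{k(n-1)+1}{2}-\dfrac{k(n-1)}{2} & \text{if } k \text{ is even}.\end{cases}$$ (The first equality is the conjecture of Faudree and Sheehan, which thus holds for all such $k$ and $n$.) -/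

import Mathlib

namespace SizeRamsey

/-- `Arrows F G H` is the relation `F ⟶ (G, H)`: every red-blue colouring of the edges of `F`
(`true` is red, `false` is blue) has a red copy of `G` or a blue copy of `H`, as a not necessarily
induced subgraph. -/
def Arrows {V α β : Type*} (F : SimpleGraph V) (G : SimpleGraph α) (H : SimpleGraph β) : Prop :=
  ∀ c : F.EdgeLabeling Bool, G.IsContained (c.labelGraph true) ∨ H.IsContained (c.labelGraph false)

/-- The Ramsey number `r(G, H)`: the least `N` with `K_N ⟶ (G, H)`. -/
noncomputable def ramseyNumber {α β : Type*} (G : SimpleGraph α) (H : SimpleGraph β) : ℕ :=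
  sInf {N : ℕ | Arrows (SimpleGraph.completeGraph (Fin N)) G H}

/-- The size Ramsey number: the least number of edges of a finite graph `F` with
`F ⟶ (G, H)`. -/
noncomputable def sizeRamseyNumber {α β : Type*} (G : SimpleGraph α) (H : SimpleGraph β) : ℕ :=
  sInf {m : ℕ | ∃ (N : ℕ) (F : SimpleGraph (Fin N)), Arrows F G H ∧ F.edgeSet.ncard = m}

/-- The restricted size Ramsey number: the least number of edges of a graph `F` on exactly
`r(G, H)` vertices with `F ⟶ (G, H)`. -/
noncomputable def restrictedSizeRamseyNumber {α β : Type*}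
    (G : SimpleGraph α) (H : SimpleGraph β) : ℕ :=
  sInf {m : ℕ | ∃ F : SimpleGraph (Fin (ramseyNumber G H)), Arrows F G H ∧ F.edgeSet.ncard = m}

/-- The star `K_{1,k}` with `k` edges. -/
abbrev star (k : ℕ) : SimpleGraph (Fin 1 ⊕ Fin k) :=
  completeBipartiteGraph (Fin 1) (Fin k)

/-- The clique `K_n`. -/
abbrev clique (n : ℕ) : SimpleGraph (Fin n) :=
  SimpleGraph.completeGraph (Fin n)

end SizeRamsey

/-!
Put `p = n - 1` and `d = k * p`. Two facts determine the size Ramsey number.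

*Lower bound.* If the vertices of a graph can be partitioned into `p` classes of induced maximum
degree less than `k`, colouring the edges inside the classes red shows that the graph does not arrow
`(K_{1,k}, K_{p+1})` (`not_arrows_of_splits`). So it is enough to bound from below the number of
edges of a graph that does not split in this way; take it vertex-critical. Lovász's partition theorem
(`splits_of_degIn_lt`) splits everything of maximum degree less than `d`. Call a possible class
*rich* if it meets at least `p - k * (k - 1)` edges more than `k * d - k.choose 2`, the number met by
`k` vertices of `K_{d+1}`; removing such a class and one colour makes induction on `p` gain that
margin. Without a rich class, every vertex has fewer than `k` non-neighbours in the set `B` of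
vertices of degree at least `d - k + 1`. If `#B ≤ d`, splitting off about `#B / k` classes that cover
`B` leaves a graph of degrees small enough for Lovász's theorem, so everything splits. If
`#B > d`, no `k + 1` vertices of `B` induce a graph of maximum degree less than `k`, so in the
complement of `G[B]` there are at most `k` non-isolated vertices, or `k` is even and it is a matching
(`degSum_le_or_matching`); either way `G[B]` has the claimed number of edges. This is
`IsCritical.le_degSum_or_hasRichClass`. Starting from the trivial bound at `p = k ^ 2`, the margins
add up to more than the initial loss by the time `p` reaches `k ^ 3 + k ^ 2`
(`le_degSum_of_not_splits`).

*Upper bound.* On `d + 1` vertices remove from the complete graph a `K_k` for odd `k`, and a matching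
that misses one vertex for even `k`. It suffices that a red graph of maximum degree less than `k`,
together with the removed edges, is `k`-colourable: a largest colour class is then a blue `K_n`
(`arrows_of_colouring`). For odd `k` a greedy colouring works. For even `k` the red graph splits into
`k / 2` classes inducing matchings, and a union of two matchings is bipartite
(`exists_two_colouring`).

Numbers of edges are counted twice, as sums of degrees (`degSum`).
-/

namespace SizeRamsey

open Finset

/-! ### Degrees inside a set, and Lovász's partition theorem -/

open scoped Classical in
/-- The number of neighbours of `v` inside the finite set `T`. -/
noncomputable def degIn {V : Type*} (G : SimpleGraph V) (T : Finset V) (v : V) : ℕ :=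
  #{w ∈ T | G.Adj v w}

/-- The sum of the degrees of the subgraph induced on `T`, that is, twice its number of edges. -/
noncomputable def degSum {V : Type*} (G : SimpleGraph V) (T : Finset V) : ℕ :=
  ∑ v ∈ T, degIn G T v

/-- The edges of `G` whose ends have the same colour under the vertex colouring `c`. -/
def monoGraph {V : Type*} (G : SimpleGraph V) (c : V → ℕ) : SimpleGraph V where
  Adj u v := G.Adj u v ∧ c u = c v
  symm := ⟨fun _ _ h => ⟨h.1.symm, h.2.symm⟩⟩
  loopless := ⟨fun _ h => G.loopless.irrefl _ h.1⟩

/-- `T` can be partitioned into `p` classes, possibly empty, each inducing a subgraph of maximum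
degree less than `k`. The colouring takes values in `ℕ`, with only its values on `T` relevant. -/
def Splits {V : Type*} (k : ℕ) (G : SimpleGraph V) (T : Finset V) (p : ℕ) : Prop :=
  ∃ c : V → ℕ, ∀ v ∈ T, c v < p ∧ degIn (monoGraph G c) T v < k

/-- `T` does not split into `p` classes, but all its subsets with one vertex fewer do. -/
def IsCritical {V : Type*} (k : ℕ) (G : SimpleGraph V) (T : Finset V) (p : ℕ) : Prop :=
  ¬ Splits k G T p ∧ ∀ T' ⊂ T, Splits k G T' p

section Degrees

variable {V : Type*} {G : SimpleGraph V} {S T : Finset V} {v : V}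

lemma degIn_congr {G' : SimpleGraph V} (h : ∀ w ∈ T, G.Adj v w ↔ G'.Adj v w) :
    degIn G T v = degIn G' T v := by
  classical
  unfold degIn
  congr 1
  exact filter_congr h

lemma degIn_mono (h : S ⊆ T) : degIn G S v ≤ degIn G T v := by
  classical
  exact card_le_card (filter_subset_filter _ h)

lemma degIn_mono_graph {G' : SimpleGraph V} (h : G ≤ G') : degIn G T v ≤ degIn G' T v := by
  classical
  exact card_le_card (monotone_filter_right _ fun w _ hw => h hw)

lemma degIn_lt_card (hv : v ∈ T) : degIn G T v < #T := by
  classical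
  refine card_lt_card ⟨filter_subset _ _, fun h => ?_⟩
  exact G.loopless.irrefl v (mem_filter.1 (h hv)).2

lemma degIn_pos : 0 < degIn G T v ↔ ∃ w ∈ T, G.Adj v w := by
  classical
  simp [degIn, card_pos, Finset.Nonempty]

lemma degIn_eq_zero : degIn G T v = 0 ↔ ∀ w ∈ T, ¬ G.Adj v w := by
  classical
  simp [degIn, filter_eq_empty_iff]

lemma degSum_mono (h : S ⊆ T) : degSum G S ≤ degSum G T :=
  (sum_le_sum fun _ _ => degIn_mono h).trans (sum_le_sum_of_subset h)

lemma sum_degIn_comm : ∑ v ∈ S, degIn G T v = ∑ v ∈ T, degIn G S v := by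
  classical
  have := sum_card_bipartiteAbove_eq_sum_card_bipartiteBelow (s := S) (t := T) G.Adj
  simpa [degIn, bipartiteAbove, bipartiteBelow, SimpleGraph.adj_comm] using this

lemma degSum_le {n : ℕ} (h : ∀ v ∈ T, degIn G T v ≤ n) : degSum G T ≤ #T * n := by
  simpa [degSum] using sum_le_card_nsmul T _ n h

variable [DecidableEq V]

lemma degIn_sdiff_add (h : S ⊆ T) : degIn G (T \ S) v + degIn G S v = degIn G T v := by
  classical
  unfold degIn
  rw [← card_union_of_disjoint, ← filter_union, sdiff_union_of_subset h]
  exact disjoint_filter_filter sdiff_disjoint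

lemma degIn_add_compl : degIn G T v + degIn Gᶜ T v = #(T.erase v) := by
  classical
  unfold degIn
  rw [← card_union_of_disjoint]
  · congr 1
    ext w
    simp only [mem_union, mem_filter, SimpleGraph.compl_adj, mem_erase]
    have := fun h : G.Adj v w => h.ne
    tauto
  · refine disjoint_left.2 fun w h h' => ?_
    simp only [mem_filter, SimpleGraph.compl_adj] at h h'
    exact h'.2.2 h.2

lemma degSum_sdiff (h : S ⊆ T) :
    degSum G (T \ S) + 2 * ∑ v ∈ S, degIn G T v = degSum G T + degSum G S := by
  have h1 : degSum G T = ∑ v ∈ T \ S, degIn G T v + ∑ v ∈ S, degIn G T v :=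
    (sum_sdiff h).symm
  have h2 : ∑ v ∈ T \ S, degIn G T v = degSum G (T \ S) + ∑ v ∈ T \ S, degIn G S v := by
    unfold degSum
    rw [← sum_add_distrib]
    exact sum_congr rfl fun v _ => (degIn_sdiff_add h).symm
  have h3 : ∑ v ∈ S, degIn G T v = ∑ v ∈ S, degIn G (T \ S) v + degSum G S := by
    unfold degSum
    rw [← sum_add_distrib]
    exact sum_congr rfl fun v _ => (degIn_sdiff_add h).symm
  have h4 := sum_degIn_comm (G := G) (S := T \ S) (T := S)
  omega

lemma degSum_erase (hv : v ∈ T) :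
    degSum G (T.erase v) + 2 * degIn G T v = degSum G T := by
  have h := degSum_sdiff (G := G) (singleton_subset_iff.2 hv)
  have h0 : degSum G {v} = 0 := by
    simp [degSum, degIn_eq_zero]
  rw [sum_singleton, h0, sdiff_singleton_eq_erase] at h
  exact h

lemma even_degSum (G : SimpleGraph V) (T : Finset V) : Even (degSum G T) := by
  induction T using Finset.induction_on with
  | empty => simp [degSum]
  | insert v T hv ih =>
    rw [← degSum_erase (mem_insert_self v T), erase_insert hv]
    exact ih.add (even_two_mul _)

lemma degSum_add_compl (G : SimpleGraph V) (T : Finset V) :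
    degSum G T + degSum Gᶜ T = #T * (#T - 1) := by
  unfold degSum
  rw [← sum_add_distrib, sum_congr rfl fun v hv => by rw [degIn_add_compl, card_erase_of_mem hv]]
  simp

end Degrees

section Splitting

variable {V : Type*} {G : SimpleGraph V} {S T : Finset V} {k p q : ℕ}

lemma splits_one (h : ∀ v ∈ T, degIn G T v < k) : Splits k G T 1 :=
  ⟨fun _ => 0, fun v hv => ⟨one_pos, (degIn_mono_graph fun _ _ hw => And.left hw).trans_lt (h v hv)⟩⟩

lemma exists_isCritical (h : ¬ Splits k G T p) : ∃ S ⊆ T, IsCritical k G S p := by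
  induction T using Finset.strongInduction with
  | H T ih =>
    by_cases hT : ∀ T' ⊂ T, Splits k G T' p
    · exact ⟨T, Subset.rfl, h, hT⟩
    · push Not at hT
      obtain ⟨T', hT', hns⟩ := hT
      obtain ⟨S, hS, hcrit⟩ := ih T' hT' hns
      exact ⟨S, hS.trans hT'.subset, hcrit⟩

variable [DecidableEq V]

/-- Two disjoint sets of colours keep the classes of `S` apart from those of `T \ S`. -/
lemma Splits.add (hST : S ⊆ T) (hS : Splits k G S p) (hT : Splits k G (T \ S) q) :
    Splits k G T (p + q) := by
  obtain ⟨c, hc⟩ := hS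
  obtain ⟨c', hc'⟩ := hT
  let f : V → ℕ := fun v => if v ∈ S then c v else p + c' v
  have key : ∀ v, degIn (monoGraph G f) T v =
      degIn (monoGraph G f) (T \ S) v + degIn (monoGraph G f) S v :=
    fun v => (degIn_sdiff_add hST).symm
  refine ⟨f, fun v hv => ?_⟩
  by_cases hvS : v ∈ S
  · have h0 : degIn (monoGraph G f) (T \ S) v = 0 := by
      rw [degIn_eq_zero]
      rintro w hw ⟨-, h⟩
      simp only [f, if_pos hvS, if_neg (mem_sdiff.1 hw).2] at h
      have := (hc v hvS).1
      omega
    have h1 : degIn (monoGraph G f) S v = degIn (monoGraph G c) S v :=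
      degIn_congr fun w hw => by simp [monoGraph, f, hvS, hw]
    rw [key, h0, h1]
    have := hc v hvS
    simp only [f, if_pos hvS]
    omega
  · have hvT : v ∈ T \ S := mem_sdiff.2 ⟨hv, hvS⟩
    have h0 : degIn (monoGraph G f) S v = 0 := by
      rw [degIn_eq_zero]
      rintro w hw ⟨-, h⟩
      simp only [f, if_pos hw, if_neg hvS] at h
      have := (hc w hw).1
      omega
    have h1 : degIn (monoGraph G f) (T \ S) v = degIn (monoGraph G c') (T \ S) v :=
      degIn_congr fun w hw => by simp [monoGraph, f, hvS, (mem_sdiff.1 hw).2]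
    rw [key, h0, h1]
    have := hc' v hvT
    simp only [f, if_neg hvS]
    omega

/-- Pigeonhole: some colour appears fewer than `m` times around `v`. Recolouring `v` with it
expresses this as a degree in `monoGraph`. -/
lemma exists_colour_degIn_lt (c : V → ℕ) (v : V) {m : ℕ} (h : degIn G T v < m * p) :
    ∃ i < p, degIn (monoGraph G (Function.update c v i)) T v < m := by
  classical
  have h' : #{w ∈ T | G.Adj v w} < #(range p) * m := by
    rw [card_range, mul_comm]; exact h
  obtain ⟨i, hi, hlt⟩ := exists_card_fiber_lt_of_card_lt_mul (f := c) h'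
  refine ⟨i, mem_range.1 hi, lt_of_le_of_lt (card_le_card fun w hw => ?_) hlt⟩
  simp only [mem_filter, monoGraph, Function.update_self] at hw ⊢
  rw [Function.update_of_ne hw.2.1.ne'] at hw
  exact ⟨⟨hw.1, hw.2.1⟩, hw.2.2.symm⟩

lemma degSum_monoGraph_update_erase (c : V → ℕ) (v : V) (i : ℕ) :
    degSum (monoGraph G (Function.update c v i)) (T.erase v) =
      degSum (monoGraph G c) (T.erase v) := by
  refine sum_congr rfl fun u hu => degIn_congr fun w hw => ?_
  simp [monoGraph, Function.update_of_ne (ne_of_mem_erase hu),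
    Function.update_of_ne (ne_of_mem_erase hw)]

/-- Lovász's partition theorem: maximum degree less than `k * q` suffices for a partition into `q`
classes of maximum degree less than `k`. A colouring with the fewest monochromatic edges works,
since a vertex with `k` neighbours of its own colour could be recoloured to remove some. -/
lemma splits_of_degIn_lt (h : ∀ v ∈ T, degIn G T v < k * q) : Splits k G T q := by
  rcases Nat.eq_zero_or_pos q with rfl | hq
  · exact ⟨fun _ => 0, fun v hv => absurd (h v hv) (by simp)⟩
  have key : ∀ N, ∀ c : V → ℕ, (∀ v ∈ T, c v < q) → degSum (monoGraph G c) T = N →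
      Splits k G T q := by
    intro N
    induction N using Nat.strong_induction_on with
    | _ N ih =>
      intro c hc hN
      by_cases hgood : ∀ v ∈ T, degIn (monoGraph G c) T v < k
      · exact ⟨c, fun v hv => ⟨hc v hv, hgood v hv⟩⟩
      push Not at hgood
      obtain ⟨v, hv, hkv⟩ := hgood
      obtain ⟨i, hi, hlt⟩ := exists_colour_degIn_lt c v (h v hv)
      refine ih _ ?_ (Function.update c v i) ?_ rfl
      · have h1 := degSum_erase (G := monoGraph G c) hv
        have h2 := degSum_erase (G := monoGraph G (Function.update c v i)) hv
        rw [degSum_monoGraph_update_erase] at h2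
        omega
      · intro w hw
        by_cases hwv : w = v
        · rw [hwv, Function.update_self]; exact hi
        · rw [Function.update_of_ne hwv]; exact hc w hw
  exact key _ (fun _ => 0) (fun _ _ => hq) rfl

lemma splits_of_card_le (h : #T ≤ k * q) : Splits k G T q :=
  splits_of_degIn_lt fun _ hv => (degIn_lt_card hv).trans_le h

/-- A vertex of degree less than `p` could be added to a class containing none of its
neighbours. -/
lemma IsCritical.le_degIn (hk : 0 < k) (hT : IsCritical k G T p) {v : V} (hv : v ∈ T) :
    p ≤ degIn G T v := by
  by_contra! hlt
  obtain ⟨c, hc⟩ := hT.2 _ (erase_ssubset hv)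
  obtain ⟨i, hi, hi0⟩ := exists_colour_degIn_lt (m := 1) (p := p) c v (by rwa [one_mul])
  refine hT.1 ⟨Function.update c v i, fun w hw => ?_⟩
  have h0 := degIn_eq_zero.1 (Nat.lt_one_iff.1 hi0)
  by_cases hwv : w = v
  · subst hwv
    rw [Function.update_self]
    omega
  · have hwT : w ∈ T.erase v := mem_erase.2 ⟨hwv, hw⟩
    have h1 : degIn (monoGraph G (Function.update c v i)) T w =
        degIn (monoGraph G c) (T.erase v) w := by
      rw [← degIn_sdiff_add (singleton_subset_iff.2 hv), sdiff_singleton_eq_erase,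
        degIn_eq_zero (T := {v}) |>.2, add_zero]
      · refine degIn_congr fun u hu => ?_
        simp [monoGraph, Function.update_of_ne hwv, Function.update_of_ne (ne_of_mem_erase hu)]
      · intro u hu
        rw [mem_singleton.1 hu]
        exact fun h => h0 w hw h.symm
    rw [Function.update_of_ne hwv, h1]
    exact hc w hwT

end Splitting

/-! ### Graphs whose small subgraphs have isolated vertices -/

section Structure

variable {V : Type*} [DecidableEq V] {N : SimpleGraph V} {B : Finset V} {k : ℕ}

/-- A graph without `k + 1` vertices inducing a subgraph free of isolated vertices either has at
most `k` non-isolated vertices, or is a matching with `k` even. For if there are more than `k`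
non-isolated vertices, a largest set `S` of at most `k` vertices without isolated vertices must have
exactly `k` of them, be joined to nothing outside, and lose this property on the removal of any
vertex. Hence `S` induces a perfect matching, and trading one of its edges for a path
on three vertices elsewhere is impossible. -/
lemma degSum_le_or_matching (hk : 2 ≤ k)
    (h : ∀ S ⊆ B, #S = k + 1 → ¬ ∀ v ∈ S, ∃ w ∈ S, N.Adj v w) :
    degSum N B ≤ k * (k - 1) ∨ (Even k ∧ ∀ v ∈ B, degIn N B v ≤ 1) := by
  classical
  let Z := {v ∈ B | ∃ w ∈ B, N.Adj v w}
  by_cases hZ : #Z ≤ k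
  · left
    have h1 : degSum N B = ∑ v ∈ Z, degIn N B v := by
      refine (sum_subset (filter_subset _ _) fun v hv hvZ => ?_).symm
      rw [degIn_eq_zero]
      intro w hw hvw
      exact hvZ (mem_filter.2 ⟨hv, w, hw, hvw⟩)
    have h2 : ∀ v ∈ Z, degIn N B v ≤ k - 1 := by
      intro v hv
      have : degIn N B v ≤ #(Z.erase v) := by
        refine card_le_card fun w hw => ?_
        rw [mem_filter] at hw
        exact mem_erase.2 ⟨hw.2.ne', mem_filter.2 ⟨hw.1, v, (mem_filter.1 hv).1, hw.2.symm⟩⟩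
      rw [card_erase_of_mem hv] at this
      omega
    rw [h1]
    calc _ ≤ #Z * (k - 1) := by simpa using sum_le_card_nsmul _ _ _ h2
      _ ≤ _ := Nat.mul_le_mul_right _ hZ
  right
  obtain ⟨S, hS, hmax⟩ := exists_max_image
    {S ∈ B.powerset | (∀ v ∈ S, ∃ w ∈ S, N.Adj v w) ∧ #S ≤ k} card
    ⟨∅, by simp⟩
  simp only [mem_filter, mem_powerset, and_imp] at hS hmax
  obtain ⟨hSB, hSfull, hSk⟩ := hS
  replace hmax : ∀ S' ⊆ B, (∀ v ∈ S', ∃ w ∈ S', N.Adj v w) → #S' ≤ k + 1 → #S' ≤ #S := by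
    intro S' h1 h2 h3
    refine hmax S' h1 h2 ?_
    have h4 : #S' ≠ k + 1 := fun h4 => h S' h1 h4 h2
    omega
  obtain ⟨z, hzZ, hzS⟩ : ∃ z ∈ Z, z ∉ S :=
    not_subset.1 fun hsub => hZ ((card_le_card hsub).trans hSk)
  obtain ⟨hzB, z', hz'B, hzz'⟩ := mem_filter.1 hzZ
  have hout : ∀ x ∈ B, x ∉ S → ∀ s ∈ S, ¬ N.Adj x s := by
    intro x hxB hxS s hs hxs
    have := hmax (insert x S) (insert_subset hxB hSB)
      (by
        intro v hv
        rcases mem_insert.1 hv with rfl | hv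
        · exact ⟨s, mem_insert_of_mem hs, hxs⟩
        · obtain ⟨w, hw, hvw⟩ := hSfull v hv
          exact ⟨w, mem_insert_of_mem hw, hvw⟩)
      (by rw [card_insert_of_notMem hxS]; omega)
    rw [card_insert_of_notMem hxS] at this
    omega
  have hz'S : z' ∉ S := fun hs => hout z hzB hzS z' hs hzz'
  have hcard2 : ∀ S' ⊆ S, #(insert z (insert z' S')) = #S' + 2 := by
    intro S' hS'
    rw [card_insert_of_notMem, card_insert_of_notMem fun hh => hz'S (hS' hh)]
    rw [mem_insert, not_or]
    exact ⟨hzz'.ne, fun hh => hzS (hS' hh)⟩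
  have hfull2 : ∀ S' : Finset V, (∀ v ∈ S', ∃ w ∈ S', N.Adj v w) →
      ∀ v ∈ insert z (insert z' S'), ∃ w ∈ insert z (insert z' S'), N.Adj v w := by
    intro S' hS' v hv
    simp only [mem_insert] at hv
    rcases hv with rfl | rfl | hv
    · exact ⟨z', by simp, hzz'⟩
    · exact ⟨z, by simp, hzz'.symm⟩
    · obtain ⟨w, hw, hvw⟩ := hS' v hv
      exact ⟨w, by simp [hw], hvw⟩
  have hsub2 : ∀ S' ⊆ S, insert z (insert z' S') ⊆ B := fun S' hS' =>
    insert_subset hzB (insert_subset hz'B (hS'.trans hSB))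
  have hSk' : #S = k := by
    by_contra hne
    have := hmax _ (hsub2 S Subset.rfl) (hfull2 S hSfull) (by rw [hcard2 S Subset.rfl]; omega)
    rw [hcard2 S Subset.rfl] at this
    omega
  have hpriv : ∀ s ∈ S, ∃ s' ∈ S, N.Adj s s' ∧ ∀ t ∈ S, N.Adj s' t → t = s := by
    intro s hs
    by_contra! hcon
    have hc := hcard2 (S.erase s) (erase_subset _ _)
    rw [card_erase_of_mem hs] at hc
    refine h _ (hsub2 (S.erase s) (erase_subset _ _)) (by omega) (hfull2 _ ?_)
    intro v hv
    obtain ⟨hvs, hvS⟩ := mem_erase.1 hv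
    obtain ⟨w, hw, hvw⟩ := hSfull v hvS
    by_cases hws : w = s
    · subst hws
      obtain ⟨t, ht, hvt, hts⟩ := hcon v hvS hvw.symm
      exact ⟨t, mem_erase.2 ⟨hts, ht⟩, hvt⟩
    · exact ⟨w, mem_erase.2 ⟨hws, hw⟩, hvw⟩
  choose! f hfS hfadj hfuniq using hpriv
  have hinj : Set.InjOn f S := by
    intro a ha b hb hab
    exact hfuniq b hb a ha (hab ▸ (hfadj a ha).symm)
  have hsurj : ∀ t ∈ S, ∃ s ∈ S, f s = t := by
    have := surj_on_of_inj_on_of_card_le (s := S) (t := S) (fun a _ => f a) hfS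
      (fun a b ha hb hab => hinj ha hb hab) le_rfl
    intro t ht
    obtain ⟨a, ha, hat⟩ := this t ht
    exact ⟨a, ha, hat.symm⟩
  have huniq : ∀ t ∈ S, ∀ a ∈ S, ∀ b ∈ S, N.Adj t a → N.Adj t b → a = b := by
    intro t ht a ha b hb hta htb
    obtain ⟨s, hs, rfl⟩ := hsurj t ht
    rw [hfuniq s hs a ha hta, hfuniq s hs b hb htb]
  have hdeg : ∀ v ∈ S, degIn N S v = 1 := by
    intro v hv
    refine le_antisymm (card_le_one.2 ?_) (degIn_pos.2 (hSfull v hv))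
    intro a ha b hb
    rw [mem_filter] at ha hb
    exact huniq v hv a ha.1 b hb.1 ha.2 hb.2
  refine ⟨?_, ?_⟩
  · have := even_degSum N S
    rwa [degSum, sum_congr rfl hdeg, sum_const, smul_eq_mul, mul_one, hSk'] at this
  intro v hvB
  refine card_le_one.2 fun a ha b hb => ?_
  rw [mem_filter] at ha hb
  by_cases hvS : v ∈ S
  · have hin : ∀ x ∈ B, N.Adj v x → x ∈ S := fun x hx hvx => by
      by_contra hxS
      exact hout x hx hxS v hvS hvx.symm
    exact huniq v hvS a (hin a ha.1 ha.2) b (hin b hb.1 hb.2) ha.2 hb.2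
  by_contra hab
  obtain ⟨s, hs⟩ : S.Nonempty := card_pos.1 (by omega)
  have haS : a ∉ S := fun haS => hout v hvB hvS a haS ha.2
  have hbS : b ∉ S := fun hbS => hout v hvB hvS b hbS hb.2
  have hfs : f s ∈ S.erase s := mem_erase.2 ⟨(hfadj s hs).ne', hfS s hs⟩
  set S' := (S.erase s).erase (f s) with hS'
  have hS'S : S' ⊆ S := (erase_subset _ _).trans (erase_subset _ _)
  have hS'c : #S' = k - 2 := by
    rw [hS', card_erase_of_mem hfs, card_erase_of_mem hs, hSk']
    omega
  refine h (insert v (insert a (insert b S'))) ?_ ?_ ?_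
  · exact insert_subset hvB (insert_subset ha.1 (insert_subset hb.1 (hS'S.trans hSB)))
  · rw [card_insert_of_notMem, card_insert_of_notMem, card_insert_of_notMem, hS'c]
    · omega
    · exact fun hh => hbS (hS'S hh)
    · rw [mem_insert, not_or]
      exact ⟨hab, fun hh => haS (hS'S hh)⟩
    · simp only [mem_insert, not_or]
      exact ⟨ha.2.ne, hb.2.ne, fun hh => hvS (hS'S hh)⟩
  · intro u hu
    simp only [mem_insert] at hu
    rcases hu with rfl | rfl | rfl | hu
    · exact ⟨a, by simp, ha.2⟩
    · exact ⟨v, by simp, ha.2.symm⟩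
    · exact ⟨v, by simp, hb.2.symm⟩
    · simp only [hS', mem_erase] at hu
      obtain ⟨w, hw, huw⟩ := hSfull u hu.2.2
      refine ⟨w, ?_, huw⟩
      have h1 : w ≠ s := by
        rintro rfl
        exact hu.1 (huniq w hw u hu.2.2 _ (hfS w hw) huw.symm (hfadj w hw))
      have h2 : w ≠ f s := by
        rintro rfl
        exact hu.2.1 (hfuniq s hs u hu.2.2 huw.symm)
      simp [hS', h1, h2, hw]

end Structure

/-! ### Edges in graphs that do not split -/

/-- A set `S ⊆ T` that can serve as one class of a splitting and meets many edges of `G[T]`: writing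
`d = k * p`, their number `∑ v ∈ S, degIn G T v - degSum G S / 2` is at least
`k * d - k.choose 2 + (p - k * (k - 1))`. The inequality is doubled and rearranged
to avoid subtraction. -/
def HasRichClass {V : Type*} (k : ℕ) (G : SimpleGraph V) (T : Finset V) (p : ℕ) : Prop :=
  ∃ S ⊆ T, (∀ v ∈ S, degIn G S v < k) ∧
    2 * (k * (k * p)) + 2 * p + 3 * k + degSum G S ≤ 2 * ∑ v ∈ S, degIn G T v + 3 * k ^ 2

/-- Twice the number of edges that can be removed from `K_{kp+1}`, for large `p`, so that it still
arrows `(K_{1,k}, K_{p+1})`. -/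
def deficit (k p : ℕ) : ℕ := if Even k then k * p else k * (k - 1)

section Step

variable {V : Type*} [DecidableEq V] {G : SimpleGraph V} {T : Finset V} {k p : ℕ}

/-- A vertex and `k` of its non-neighbours form a possible class. -/
lemma hasRichClass_of_nonadj {K : Finset V} {v : V} {a : ℕ} (hv : v ∈ T) (hKT : K ⊆ T)
    (hvK : v ∉ K) (hK : #K = k) (hadj : ∀ u ∈ K, ¬ G.Adj v u) (ha : ∀ u ∈ K, a ≤ degIn G T u)
    (hk : 0 < k) (h : k * (k * p) + p + k ≤ degIn G T v + k * a + k ^ 2) :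
    HasRichClass k G T p := by
  have hv0 : degIn G (insert v K) v = 0 := by
    rw [degIn_eq_zero]
    intro w hw
    rcases mem_insert.1 hw with rfl | hw
    · exact G.loopless.irrefl _
    · exact hadj w hw
  have hu : ∀ u ∈ K, degIn G (insert v K) u ≤ k - 1 := by
    classical
    intro u hu
    have : degIn G (insert v K) u ≤ #(K.erase u) := by
      refine card_le_card fun w hw => ?_
      rw [mem_filter] at hw
      refine mem_erase.2 ⟨hw.2.ne', ?_⟩
      rcases mem_insert.1 hw.1 with rfl | hwK
      · exact absurd hw.2.symm (hadj u hu)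
      · exact hwK
    rwa [card_erase_of_mem hu, hK] at this
  refine ⟨insert v K, insert_subset hv hKT, ?_, ?_⟩
  · intro w hw
    rcases mem_insert.1 hw with rfl | hw
    · omega
    · have := hu w hw
      omega
  · have h1 : degSum G (insert v K) ≤ k * (k - 1) := by
      rw [degSum, sum_insert hvK, hv0, zero_add]
      simpa [hK] using sum_le_card_nsmul K _ _ hu
    have h2 : k * a ≤ ∑ u ∈ K, degIn G T u := by
      simpa [hK] using card_nsmul_le_sum K _ _ ha
    rw [sum_insert hvK]
    have h3 : k * (k - 1) + k = k ^ 2 := by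
      obtain ⟨l, rfl⟩ : ∃ l, k = l + 1 := ⟨k - 1, by omega⟩
      simp; ring
    omega

/-- If `T` is critical and has no rich class then `T` has at least as many edges as the claimed
extremal graph. Let `B` consist of the vertices of degree at least `d - k + 1`, where `d = k * p`.
Without a rich class every vertex has fewer than `k` non-neighbours in `B`. If `#B ≤ d` then a
set `U`, obtained from `B` by rounding its size up to a multiple of `k` with further vertices of high
degree, as far as there are any, splits into `⌈#B / k⌉` classes, and the rest is sparse enough for
Lovász's theorem. If `#B > d` then the complement of
`G[B]` has the structure of `degSum_le_or_matching`, so `G[B]` alone has enough edges. -/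
lemma IsCritical.le_degSum_or_hasRichClass (hk : 2 ≤ k) (hp : k ^ 2 < p)
    (hT : IsCritical k G T p) :
    k * p * (k * p + 1) ≤ degSum G T + deficit k p ∨ HasRichClass k G T p := by
  classical
  by_contra! hcon
  obtain ⟨hlt, hrich⟩ := hcon
  have hmin : ∀ v ∈ T, p ≤ degIn G T v := fun v hv => hT.le_degIn (by omega) hv
  have hkp : k ≤ p := by nlinarith
  have hdp : k * p = (k - 1) * p + p := by
    obtain ⟨l, rfl⟩ : ∃ l, k = l + 1 := ⟨k - 1, by omega⟩
    simp; ring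
  have hdp' : p ≤ (k - 1) * p := Nat.le_mul_of_pos_left _ (by omega)
  set d := k * p with hd
  set B := {v ∈ T | d + 1 ≤ degIn G T v + k} with hB
  set B₂ := {v ∈ T | d + 2 ≤ degIn G T v + 2 * k} with hB₂
  have hBT : B ⊆ T := filter_subset _ _
  have hB₂T : B₂ ⊆ T := filter_subset _ _
  have hBB₂ : B ⊆ B₂ := by
    intro v hv
    rw [hB, mem_filter] at hv
    rw [hB₂, mem_filter]
    exact ⟨hv.1, by omega⟩
  have hnonB : ∀ v ∈ T, degIn Gᶜ B v < k := by
    intro v hv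
    by_contra! hge
    obtain ⟨K, hK, hKc⟩ := exists_subset_card_eq hge
    have hK' : ∀ u ∈ K, u ∈ B ∧ v ≠ u ∧ ¬ G.Adj v u := fun u hu => by
      simpa [SimpleGraph.compl_adj] using hK hu
    refine hrich (hasRichClass_of_nonadj (a := d + 1 - k) hv (fun u hu => hBT (hK' u hu).1)
      (fun hvK => (hK' v hvK).2.1 rfl) hKc (fun u hu => (hK' u hu).2.2) ?_ (by omega) ?_)
    · intro u hu
      have := (mem_filter.1 (hK' u hu).1).2
      omega
    · rw [← hd]
      have := hmin v hv
      have h1 : k * (d + 1 - k) + k ^ 2 = k * d + k := by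
        rw [sq, ← mul_add, Nat.sub_add_cancel (by nlinarith)]
        ring
      omega
  have hnonB₂ : ∀ v ∈ B₂, degIn Gᶜ B₂ v < k := by
    intro v hv
    by_contra! hge
    obtain ⟨K, hK, hKc⟩ := exists_subset_card_eq hge
    have hK' : ∀ u ∈ K, u ∈ B₂ ∧ v ≠ u ∧ ¬ G.Adj v u := fun u hu => by
      simpa [SimpleGraph.compl_adj] using hK hu
    refine hrich (hasRichClass_of_nonadj (a := d + 2 - 2 * k) (hB₂T hv)
      (fun u hu => hB₂T (hK' u hu).1)
      (fun hvK => (hK' v hvK).2.1 rfl) hKc (fun u hu => (hK' u hu).2.2) ?_ (by omega) ?_)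
    · intro u hu
      have := (mem_filter.1 (hK' u hu).1).2
      omega
    · rw [← hd]
      have := (mem_filter.1 hv).2
      have h1 : k * (d + 2 - 2 * k) + 2 * k ^ 2 = k * d + 2 * k := by
        rw [show 2 * k ^ 2 = k * (2 * k) by ring, ← mul_add, Nat.sub_add_cancel (by omega)]
        ring
      -- The slack `(k - 1) * (p - k - 2)` of the inequality is nonnegative.
      have h2 : (k - 1) * (k + 2) ≤ (k - 1) * p := Nat.mul_le_mul_left _ (by nlinarith)
      have h3 : (k - 1) * (k + 2) + 2 = k ^ 2 + k := by
        obtain ⟨l, rfl⟩ : ∃ l, k = l + 1 := ⟨k - 1, by omega⟩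
        simp; ring
      omega
  by_cases hBd : #B ≤ d
  · -- `j` is the ceiling of `#B / k`
    obtain ⟨j, hj1, hj2⟩ : ∃ j, #B ≤ k * j ∧ k * j < #B + k := by
      refine ⟨(#B + (k - 1)) / k, ?_, ?_⟩
      · have := Nat.lt_mul_div_succ (#B + (k - 1)) (show 0 < k by omega)
        rw [mul_add] at this
        omega
      · have := Nat.mul_div_le (#B + (k - 1)) k
        omega
    have hjp : j ≤ p := by
      by_contra! hlt
      have : k * (p + 1) ≤ k * j := Nat.mul_le_mul_left _ hlt
      rw [mul_add] at this
      omega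
    obtain ⟨U, hBU, hUB₂, hUc, hU⟩ : ∃ U, B ⊆ U ∧ U ⊆ B₂ ∧ #U ≤ k * j ∧
        (#U = k * j ∨ U = B₂) := by
      by_cases h : k * j ≤ #B₂
      · obtain ⟨U, h1, h2, h3⟩ := exists_subsuperset_card_eq hBB₂ hj1 h
        exact ⟨U, h1, h2, h3.le, Or.inl h3⟩
      · exact ⟨B₂, hBB₂, Subset.rfl, by omega, Or.inr rfl⟩
    have hUT : U ⊆ T := hUB₂.trans hB₂T
    have hrest : ∀ v ∈ T \ U, degIn G (T \ U) v < k * (p - j) := by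
      intro v hv
      obtain ⟨hvT, hvU⟩ := mem_sdiff.1 hv
      have h1 := degIn_sdiff_add (G := G) (v := v) hUT
      have h2 : degIn G U v + degIn Gᶜ U v = #U := by
        rw [degIn_add_compl, erase_eq_of_notMem hvU]
      have h3 : degIn G B v + degIn Gᶜ B v = #B := by
        rw [degIn_add_compl, erase_eq_of_notMem fun h => hvU (hBU h)]
      have h4 : k * (p - j) + k * j = d := by
        rw [← mul_add, Nat.sub_add_cancel hjp]
      have h5 := hnonB v hvT
      have h6 : degIn G B v ≤ degIn G U v := degIn_mono hBU
      by_cases hvB₂ : v ∈ B₂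
      · have h7 : #U = k * j := hU.resolve_right fun h => hvU (h ▸ hvB₂)
        have h8 := (degIn_mono hUB₂).trans_lt (hnonB₂ v hvB₂)
        have h9 : ¬ d + 1 ≤ degIn G T v + k := fun h => hvU (hBU (mem_filter.2 ⟨hvT, h⟩))
        omega
      · have h7 : ¬ d + 2 ≤ degIn G T v + 2 * k := fun h => hvB₂ (mem_filter.2 ⟨hvT, h⟩)
        omega
    apply hT.1
    rw [← Nat.add_sub_cancel' hjp]
    exact Splits.add hUT (splits_of_card_le hUc) (splits_of_degIn_lt hrest)
  · obtain ⟨B', hB'B, hB'c⟩ := exists_subset_card_eq (show d + 1 ≤ #B by omega)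
    have hB'T := hB'B.trans hBT
    have hstruct : ∀ S ⊆ B', #S = k + 1 → ¬ ∀ v ∈ S, ∃ w ∈ S, Gᶜ.Adj v w := by
      intro S hSB hSc hfull
      have hdeg : ∀ v ∈ S, degIn G S v ≤ k - 1 := by
        intro v hv
        have h1 := degIn_add_compl (G := G) (T := S) (v := v)
        have h2 := degIn_pos.2 (hfull v hv)
        rw [card_erase_of_mem hv, hSc] at h1
        omega
      refine hrich ⟨S, hSB.trans hB'T, fun v hv => ?_, ?_⟩
      · have := hdeg v hv
        omega
      · rw [← hd]
        have h1 : degSum G S ≤ (k + 1) * (k - 1) := hSc ▸ degSum_le hdeg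
        have h2 : (k + 1) * (d + 1 - k) ≤ ∑ v ∈ S, degIn G T v := by
          rw [← hSc, ← smul_eq_mul]
          refine card_nsmul_le_sum S _ _ fun v hv => ?_
          have := (mem_filter.1 (hB'B (hSB hv))).2
          omega
        have h3 : (k + 1) * (d + 1 - k) + k ^ 2 = (k + 1) * d + 1 := by
          obtain ⟨e, he⟩ : ∃ e, d = k + e := ⟨d - k, by omega⟩
          rw [he, show k + e + 1 - k = e + 1 by omega]
          ring
        have h4 : (k + 1) * (k - 1) + 1 = k ^ 2 := by
          obtain ⟨l, rfl⟩ : ∃ l, k = l + 1 := ⟨k - 1, by omega⟩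
          simp; ring
        have h5 : (k + 1) * d = k * d + d := by ring
        have h6 : (k - 1) * 2 ≤ (k - 1) * p := Nat.mul_le_mul_left _ (by omega)
        omega
    have hcompl := degSum_add_compl G B'
    rw [hB'c, Nat.add_sub_cancel, mul_comm] at hcompl
    have hmono : degSum G B' ≤ degSum G T := degSum_mono hB'T
    have hkd : k * (k - 1) ≤ d := Nat.mul_le_mul_left _ (by omega)
    rcases degSum_le_or_matching hk hstruct with h | ⟨heven, h⟩
    · unfold deficit at hlt
      split_ifs at hlt <;> omega
    · -- `B'` has odd size, so the matching misses a vertex.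
      have h1 : degSum Gᶜ B' ≤ (d + 1) * 1 := hB'c ▸ degSum_le h
      have h2 := even_degSum Gᶜ B'
      have h3 : Even d := heven.mul_right p
      rw [deficit, if_pos heven] at hlt
      rw [Nat.even_iff] at h2 h3
      omega

/-- The lower bound for the number of edges of a graph that does not split into `k ^ 2 + x` classes,
by induction on `x`. The second alternative covers the small values of `x`, where it is weak: it
starts from the trivial bound at `x = 0`, and the removal of a rich class improves it, relative to a
complete graph, by at least `x` edges at step `x`. -/
lemma le_degSum_or_of_not_splits (hk : 2 ≤ k) (x : ℕ) (hT : ¬ Splits k G T (k ^ 2 + x)) :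
    k * (k ^ 2 + x) * (k * (k ^ 2 + x) + 1) ≤ degSum G T + deficit k (k ^ 2 + x) ∨
      k * (k ^ 2 + x) * (k * (k ^ 2 + x) + 1) + x * (x + 1) ≤
        degSum G T + k ^ 3 * (k ^ 3 + 1) := by
  induction x generalizing T with
  | zero =>
    right
    have : k * (k ^ 2 + 0) = k ^ 3 := by ring
    rw [this]
    omega
  | succ x ih =>
    obtain ⟨T', hT'T, hcrit⟩ := exists_isCritical hT
    have hmono : degSum G T' ≤ degSum G T := degSum_mono hT'T
    rcases hcrit.le_degSum_or_hasRichClass hk (by omega) with h | ⟨S, hST, hS, hrich⟩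
    · left
      omega
    have hns : ¬ Splits k G (T' \ S) (k ^ 2 + x) := fun h => by
      have := Splits.add hST (splits_one hS) h
      rw [add_comm 1] at this
      exact hcrit.1 this
    have hsum := degSum_sdiff (G := G) hST
    have hdef : deficit k (k ^ 2 + x) ≤ deficit k (k ^ 2 + (x + 1)) := by
      unfold deficit
      split_ifs
      · exact Nat.mul_le_mul_left _ (by omega)
      · exact le_rfl
    rcases ih hns with h | h
    · left
      nlinarith
    · right
      nlinarith

/-- For large `p` the second alternative of `le_degSum_or_of_not_splits` is absorbed: with
`p = k ^ 2 + x` and `x ≥ k ^ 3` its extra term exceeds the initial loss. -/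
lemma le_degSum_of_not_splits (hk : 2 ≤ k) (hp : k ^ 3 + k ^ 2 ≤ p) (hT : ¬ Splits k G T p) :
    k * p * (k * p + 1) ≤ degSum G T + deficit k p := by
  obtain ⟨x, rfl⟩ : ∃ x, p = k ^ 2 + x := ⟨p - k ^ 2, by omega⟩
  rcases le_degSum_or_of_not_splits hk x hT with h | h
  · exact h
  · have : k ^ 3 * (k ^ 3 + 1) ≤ x * (x + 1) := Nat.mul_le_mul (by omega) (by omega)
    omega

end Step

/-! ### Arrowing and vertex colourings -/

section Arrowing

variable {V : Type*} {k p : ℕ}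

lemma star_isContained_iff [Fintype V] {R : SimpleGraph V} :
    (star k).IsContained R ↔ ∃ v, k ≤ degIn R univ v := by
  classical
  constructor
  · rintro ⟨f⟩
    refine ⟨f (Sum.inl 0), ?_⟩
    have hinj : Function.Injective fun i : Fin k => f (Sum.inr i) :=
      fun i j hij => Sum.inr_injective (f.injective hij)
    calc k = #(univ.image fun i : Fin k => f (Sum.inr i)) := by
          rw [card_image_of_injective _ hinj, card_univ, Fintype.card_fin]
      _ ≤ _ := by
          refine card_le_card fun w hw => ?_
          obtain ⟨i, -, rfl⟩ := mem_image.1 hw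
          exact mem_filter.2 ⟨mem_univ _, f.toHom.map_adj (by simp)⟩
  · rintro ⟨v, hv⟩
    obtain ⟨K, hK, hKc⟩ := exists_subset_card_eq hv
    have hadj : ∀ u ∈ K, R.Adj v u := fun u hu => (mem_filter.1 (hK hu)).2
    let g : Fin k ↪ V := ((finCongr hKc.symm).trans K.equivFin.symm).toEmbedding.trans
      (Function.Embedding.subtype _)
    have hg : ∀ i, g i ∈ K := fun i => (K.equivFin.symm _).2
    let f : star k →g R :=
      { toFun := Sum.elim (fun _ => v) g
        map_rel' := by
          rintro (a | a) (b | b) h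
          · simp at h
          · exact hadj _ (hg b)
          · exact (hadj _ (hg a)).symm
          · simp at h }
    refine ⟨⟨f, ?_⟩⟩
    rintro (a | a) (b | b) h
    · rw [Subsingleton.elim a b]
    · exact absurd h (hadj _ (hg b)).ne
    · exact absurd h.symm (hadj _ (hg a)).ne
    · exact congrArg Sum.inr (g.injective h)

/-- Colour the edges inside the classes red; the blue graph is then `p`-partite. -/
lemma not_arrows_of_splits [Fintype V] {G : SimpleGraph V} (h : Splits k G univ p) :
    ¬ Arrows G (star k) (clique (p + 1)) := by
  classical
  obtain ⟨c, hc⟩ := h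
  intro harr
  let l : G.EdgeLabeling Bool := SimpleGraph.EdgeLabeling.mk (fun x y _ => decide (c x = c y))
    (fun x y _ => by simp [eq_comm])
  have hl : ∀ b x y, (l.labelGraph b).Adj x y → decide (c x = c y) = b := by
    intro b x y hxy
    obtain ⟨_, h⟩ := (SimpleGraph.EdgeLabeling.labelGraph_adj x y).1 hxy
    exact h
  rcases harr l with h | h
  · obtain ⟨v, hv⟩ := star_isContained_iff.1 h
    have h1 : l.labelGraph true ≤ monoGraph G c := fun x y hxy =>
      ⟨l.labelGraph_le hxy, by simpa using hl _ _ _ hxy⟩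
    exact absurd (hv.trans (degIn_mono_graph h1)) (not_le.2 (hc v (mem_univ v)).2)
  · obtain ⟨f⟩ := h
    obtain ⟨i, -, j, -, hij, hcij⟩ := exists_ne_map_eq_of_card_lt_of_maps_to
      (s := (univ : Finset (Fin (p + 1)))) (t := range p) (f := fun i => c (f i))
      (by simp) (fun i _ => by simpa using (hc (f i) (mem_univ _)).1)
    have hadj : (l.labelGraph false).Adj (f i) (f j) :=
      f.toHom.map_adj (show (⊤ : SimpleGraph (Fin (p + 1))).Adj i j from hij)
    have := hl _ _ _ hadj
    simp only [decide_eq_false_iff_not] at this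
    exact this hcij

/-- A class of size `p + 1` in the vertex colouring `c` is a blue clique. -/
lemma arrows_of_colouring [Fintype V] {F : SimpleGraph V} (hV : k * p < Fintype.card V)
    (h : ∀ R ≤ F, (∀ v, degIn R univ v < k) → ∃ c : V → ℕ, (∀ v, c v < k) ∧
      ∀ u v, u ≠ v → c u = c v → F.Adj u v ∧ ¬ R.Adj u v) :
    Arrows F (star k) (clique (p + 1)) := by
  classical
  intro l
  by_cases hstar : (star k).IsContained (l.labelGraph true)
  · exact Or.inl hstar
  right
  rw [star_isContained_iff] at hstar
  push Not at hstar
  obtain ⟨c, hck, hc⟩ := h _ l.labelGraph_le hstar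
  obtain ⟨i, -, hi⟩ := exists_lt_card_fiber_of_mul_lt_card_of_maps_to (s := (univ : Finset V))
    (t := range k) (f := c) (n := p) (fun v _ => mem_range.2 (hck v))
    (by rwa [card_range, card_univ])
  obtain ⟨K, hK, hKc⟩ := exists_subset_card_eq (Nat.succ_le_of_lt hi)
  let g : Fin (p + 1) ↪ V := ((finCongr hKc.symm).trans K.equivFin.symm).toEmbedding.trans
    (Function.Embedding.subtype _)
  have hg : ∀ i, g i ∈ K := fun i => (K.equivFin.symm _).2
  refine ⟨⟨⟨g, fun {a b} hab => ?_⟩, g.injective⟩⟩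
  have hne : g a ≠ g b := fun h => (show a ≠ b from hab) (g.injective h)
  have ha := (mem_filter.1 (hK (hg a))).2
  have hb := (mem_filter.1 (hK (hg b))).2
  obtain ⟨hF, hR⟩ := hc _ _ hne (ha.trans hb.symm)
  rw [SimpleGraph.EdgeLabeling.labelGraph_adj] at hR ⊢
  push Not at hR
  exact ⟨hF, by simpa using hR hF⟩

lemma Arrows.mono {α β : Type*} {F F' : SimpleGraph V} {G : SimpleGraph α} {H : SimpleGraph β}
    (hF : F ≤ F') (h : Arrows F G H) : Arrows F' G H := by
  intro l
  let l' : F.EdgeLabeling Bool := l.pullback (SimpleGraph.Hom.ofLE hF)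
  have hl : ∀ b, l'.labelGraph b ≤ l.labelGraph b := by
    intro b x y hxy
    obtain ⟨hadj, hb⟩ := (SimpleGraph.EdgeLabeling.labelGraph_adj x y).1 hxy
    exact (SimpleGraph.EdgeLabeling.labelGraph_adj x y).2 ⟨hF hadj, hb⟩
  exact (h l').imp (fun h => h.mono_right (hl _)) (fun h => h.mono_right (hl _))

lemma degSum_univ [Fintype V] (G : SimpleGraph V) : degSum G univ = 2 * G.edgeSet.ncard := by
  classical
  rw [← SimpleGraph.coe_edgeFinset, Set.ncard_coe_finset, ← G.sum_degrees_eq_twice_card_edges]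
  refine sum_congr rfl fun v _ => ?_
  rw [← SimpleGraph.card_neighborFinset_eq_degree, degIn]
  congr 1
  ext w
  simp

end Arrowing

section Colourings

variable {V : Type*} {k q : ℕ}

/-- A greedy colouring with the vertices of `A` coloured first, all differently. -/
lemma exists_colouring_injOn [Fintype V] {R : SimpleGraph V} (hR : ∀ v, degIn R univ v < k)
    {A : Finset V} (hA : #A ≤ k) :
    ∃ c : V → ℕ, (∀ v, c v < k) ∧ Set.InjOn c A ∧ ∀ u v, R.Adj u v → c u ≠ c v := by
  classical
  have key : ∀ T : Finset V, ∃ c : V → ℕ, (∀ v ∈ A ∪ T, c v < k) ∧ Set.InjOn c A ∧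
      ∀ u ∈ A ∪ T, ∀ v ∈ A ∪ T, R.Adj u v → c u ≠ c v := by
    intro T
    induction T using Finset.induction_on with
    | empty =>
      have hc : ∃ c : V → ℕ, (∀ v ∈ A, c v < k) ∧ Set.InjOn c A := by
        refine ⟨fun v => if h : v ∈ A then A.equivFin ⟨v, h⟩ else 0, fun v hv => ?_, ?_⟩
        · simp only [dif_pos hv]
          exact (A.equivFin _).2.trans_le hA
        · intro u hu v hv huv
          simp only [dif_pos (mem_coe.1 hu), dif_pos (mem_coe.1 hv)] at huv
          simpa using A.equivFin.injective (Fin.ext huv)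
      obtain ⟨c, h1, h2⟩ := hc
      refine ⟨c, by simpa using h1, h2, fun u hu v hv huv h => huv.ne ?_⟩
      rw [union_empty] at hu hv
      exact h2 hu hv h
    | insert v T hv ih =>
      by_cases hvA : v ∈ A ∪ T
      · rwa [union_insert, insert_eq_of_mem hvA]
      obtain ⟨c, h1, h2, h3⟩ := ih
      obtain ⟨i, hi, hi0⟩ := exists_colour_degIn_lt (m := 1) (p := k) c v
        (by rw [one_mul]; exact hR v)
      have h0 := degIn_eq_zero.1 (Nat.lt_one_iff.1 hi0)
      have h4 : ∀ u ∈ A ∪ T, R.Adj v u → c u ≠ i := fun u hu hvu h =>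
        h0 u (mem_univ u) ⟨hvu, by
          rw [Function.update_self, Function.update_of_ne hvu.ne', h]⟩
      have hupd : ∀ u ∈ A ∪ T, Function.update c v i u = c u := fun u hu =>
        Function.update_of_ne (ne_of_mem_of_not_mem hu hvA) _ _
      refine ⟨Function.update c v i, fun u hu => ?_, fun a ha b hb hab => ?_, ?_⟩
      · rw [union_insert, mem_insert] at hu
        rcases hu with rfl | hu
        · rwa [Function.update_self]
        · rw [hupd u hu]
          exact h1 u hu
      · rw [hupd a (mem_union_left _ ha), hupd b (mem_union_left _ hb)] at hab
        exact h2 ha hb hab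
      · intro u hu w hw huw
        rw [union_insert, mem_insert] at hu hw
        rcases hu with rfl | hu <;> rcases hw with rfl | hw
        · exact absurd rfl huw.ne
        · rw [Function.update_self, hupd w hw]
          exact (h4 w hw huw).symm
        · rw [Function.update_self, hupd u hu]
          exact h4 u hu huw.symm
        · rw [hupd u hu, hupd w hw]
          exact h3 u hu w hw huw
  obtain ⟨c, h1, h2, h3⟩ := key univ
  have hmem : ∀ v, v ∈ A ∪ univ := fun v => mem_union_right _ (mem_univ v)
  exact ⟨c, fun v => h1 v (hmem v), h2, fun u v => h3 u (hmem u) v (hmem v)⟩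

/-- The union of two matchings is bipartite. An edge `va` of the first matching is
removed along with its ends, whose partners under the second matching are then joined to each other
in it: a colouring of what remains extends. -/
lemma exists_two_colouring (R : SimpleGraph V) (hR : ∀ x y z, R.Adj x y → R.Adj x z → y = z)
    (T : Finset V) : ∀ M : SimpleGraph V, (∀ x y z, M.Adj x y → M.Adj x z → y = z) →
      ∃ c : V → Bool, ∀ u ∈ T, ∀ v ∈ T, R.Adj u v ∨ M.Adj u v → c u ≠ c v := by
  classical
  induction T using Finset.strongInduction with
  | H T ih =>
    intro M hM
    rcases T.eq_empty_or_nonempty with rfl | ⟨v, hv⟩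
    · exact ⟨fun _ => true, by simp⟩
    by_cases hva : ∃ a ∈ T, R.Adj v a
    · obtain ⟨a, ha, hva⟩ := hva
      let M' : SimpleGraph V :=
        { Adj := fun x y => (x ≠ v ∧ x ≠ a ∧ y ≠ v ∧ y ≠ a) ∧
            (M.Adj x y ∨ (M.Adj x v ∧ M.Adj y a) ∨ (M.Adj x a ∧ M.Adj y v))
          symm := ⟨fun x y h => by
            have := fun h : M.Adj x y => h.symm
            tauto⟩
          loopless := ⟨fun x h => by
            have h1 := hM x v a
            have h2 := hva.ne
            have h3 := M.loopless.irrefl x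
            tauto⟩ }
      have hM' : ∀ x y z, M'.Adj x y → M'.Adj x z → y = z := by
        intro x y z hxy hxz
        have h1 := hM x
        have h2 := hM v
        have h3 := hM a
        have h4 := hva.ne
        have h5 := fun a b => M.adj_comm a b
        simp only [M'] at hxy hxz
        grind
      obtain ⟨c, hc⟩ := ih ((T.erase v).erase a)
        (((erase_subset _ _).trans_ssubset (erase_ssubset hv))) M' hM'
      let T' := (T.erase v).erase a
      obtain ⟨cv, hcv, hca⟩ : ∃ cv : Bool, (∀ b ∈ T', M.Adj v b → c b ≠ cv) ∧
          ∀ b ∈ T', M.Adj a b → c b = cv := by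
        by_cases h : ∃ b ∈ T', M.Adj v b
        · obtain ⟨b₀, hb₀, hvb₀⟩ := h
          refine ⟨!c b₀, fun b _ hvb => ?_, fun b hb hab => ?_⟩
          · rw [hM v _ _ hvb hvb₀]
            simp
          · have h0 := mem_erase.1 hb₀
            have h1 := mem_erase.1 hb
            exact Bool.eq_not.2 <| hc b hb b₀ hb₀ <| Or.inr
              ⟨⟨ne_of_mem_erase h1.2, h1.1, ne_of_mem_erase h0.2, h0.1⟩,
                Or.inr (Or.inr ⟨hab.symm, hvb₀.symm⟩)⟩
        · push Not at h
          by_cases h' : ∃ b ∈ T', M.Adj a b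
          · obtain ⟨b₁, hb₁, hab₁⟩ := h'
            exact ⟨c b₁, fun b hb hvb => absurd hvb (h b hb),
              fun b _ hab => by rw [hM a _ _ hab hab₁]⟩
          · push Not at h'
            exact ⟨true, fun b hb hvb => absurd hvb (h b hb),
              fun b hb hab => absurd hab (h' b hb)⟩
      refine ⟨fun x => if x = v then cv else if x = a then !cv else c x, ?_⟩
      have hT' : ∀ x ∈ T, x ≠ v → x ≠ a → x ∈ T' := fun x h1 h2 h3 => by
        simp [T', h1, h2, h3]
      have hv' : ∀ x ∈ T, x ≠ v → x ≠ a → R.Adj v x ∨ M.Adj v x → c x ≠ cv := by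
        intro x hx h1 h2 h3
        rcases h3 with h3 | h3
        · exact absurd (hR v _ _ h3 hva) h2
        · exact hcv x (hT' x hx h1 h2) h3
      have ha' : ∀ x ∈ T, x ≠ v → x ≠ a → R.Adj a x ∨ M.Adj a x → c x ≠ !cv := by
        intro x hx h1 h2 h3
        rcases h3 with h3 | h3
        · exact absurd (hR a _ _ h3 hva.symm) h1
        · rw [hca x (hT' x hx h1 h2) h3]
          simp
      have hcc : ∀ x ∈ T, ∀ y ∈ T, x ≠ v → x ≠ a → y ≠ v → y ≠ a →
          R.Adj x y ∨ M.Adj x y → c x ≠ c y := by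
        intro x hx y hy h1 h2 h3 h4 h5
        exact hc x (hT' x hx h1 h2) y (hT' y hy h3 h4)
          (h5.imp_right fun h => ⟨⟨h1, h2, h3, h4⟩, Or.inl h⟩)
      intro x hx y hy hxy
      have hne : x ≠ y := by
        rcases hxy with h | h <;> exact h.ne
      have hyx : R.Adj y x ∨ M.Adj y x := hxy.imp SimpleGraph.Adj.symm SimpleGraph.Adj.symm
      clear hc hcv hca hT' hM' M' T' hR hM ih
      dsimp only
      split_ifs <;> grind
    · push Not at hva
      obtain ⟨c, hc⟩ := ih _ (erase_ssubset hv) M hM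
      obtain ⟨cv, hcv⟩ : ∃ cv : Bool, ∀ b ∈ T, M.Adj v b → c b ≠ cv := by
        by_cases h : ∃ b ∈ T, M.Adj v b
        · obtain ⟨b₀, -, hvb₀⟩ := h
          exact ⟨!c b₀, fun b _ hvb => by rw [hM v _ _ hvb hvb₀]; simp⟩
        · push Not at h
          exact ⟨true, fun b hb hvb => absurd hvb (h b hb)⟩
      refine ⟨Function.update c v cv, fun x hx y hy hxy => ?_⟩
      have hne : x ≠ y := by
        rcases hxy with h | h <;> exact h.ne
      by_cases hxv : x = v
      · subst hxv
        rw [Function.update_self, Function.update_of_ne hne.symm]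
        exact (hcv y hy (hxy.resolve_left (hva y hy))).symm
      · by_cases hyv : y = v
        · subst hyv
          rw [Function.update_self, Function.update_of_ne hxv]
          exact hcv x hx (hxy.resolve_left fun h => hva x hx h.symm).symm
        · rw [Function.update_of_ne hxv, Function.update_of_ne hyv]
          exact hc x (mem_erase.2 ⟨hxv, hx⟩) y (mem_erase.2 ⟨hyv, hy⟩) hxy

end Colourings

/-! ### Extremal graphs and the size Ramsey numbers -/

section Extremal

variable {V : Type*} {k p : ℕ}

/-- The complete graph on the vertex set `A`, as a graph on `V`. -/
def cliqueOn (A : Finset V) : SimpleGraph V where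
  Adj u v := u ∈ A ∧ v ∈ A ∧ u ≠ v
  symm := ⟨fun _ _ h => ⟨h.2.1, h.1, h.2.2.symm⟩⟩
  loopless := ⟨fun _ h => h.2.2 rfl⟩

lemma arrows_compl_cliqueOn [Fintype V] (hV : k * p < Fintype.card V) {A : Finset V}
    (hA : #A = k) : Arrows (cliqueOn A)ᶜ (star k) (clique (p + 1)) := by
  refine arrows_of_colouring hV fun R _ hdeg => ?_
  obtain ⟨c, hck, hinj, hc⟩ := exists_colouring_injOn hdeg hA.le
  refine ⟨c, hck, fun u v huv hcuv => ⟨?_, fun h => hc u v h hcuv⟩⟩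
  rw [SimpleGraph.compl_adj]
  exact ⟨huv, fun h => huv (hinj h.1 h.2.1 hcuv)⟩

lemma le_degSum_cliqueOn [Fintype V] {A : Finset V} :
    #A * (#A - 1) ≤ degSum (cliqueOn A) univ := by
  classical
  rw [← smul_eq_mul]
  refine (card_nsmul_le_sum A (degIn (cliqueOn A) univ) _ fun v hv => ?_).trans
    (sum_le_sum_of_subset (subset_univ A))
  rw [← card_erase_of_mem hv]
  refine card_le_card fun w hw => mem_filter.2 ⟨mem_univ w, hv, mem_of_mem_erase hw, ?_⟩
  exact (ne_of_mem_erase hw).symm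

/-- A red graph `R` of maximum degree less than `k = 2q` splits into `q` classes inducing matchings,
so that each class induces a bipartite subgraph of `R ∪ M`. -/
lemma arrows_compl_matching [Fintype V] (hV : k * p < Fintype.card V) (hk : Even k)
    {M : SimpleGraph V} (hM : ∀ x y z, M.Adj x y → M.Adj x z → y = z) :
    Arrows Mᶜ (star k) (clique (p + 1)) := by
  classical
  obtain ⟨q, rfl⟩ := hk
  refine arrows_of_colouring hV fun R _ hdeg => ?_
  obtain ⟨c, hc⟩ : Splits 2 R univ q :=
    splits_of_degIn_lt fun v _ => (hdeg v).trans_eq (two_mul q).symm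
  have hmatch : ∀ x y z, (monoGraph R c).Adj x y → (monoGraph R c).Adj x z → y = z := by
    intro x y z hxy hxz
    have := Nat.le_of_lt_succ (hc x (mem_univ x)).2
    exact card_le_one.1 this y (mem_filter.2 ⟨mem_univ y, hxy⟩) z (mem_filter.2 ⟨mem_univ z, hxz⟩)
  obtain ⟨b, hb⟩ := exists_two_colouring (monoGraph R c) hmatch univ M hM
  refine ⟨fun v => 2 * c v + (b v).toNat, fun v => ?_, fun u v huv h => ?_⟩
  · have h1 := (hc v (mem_univ v)).1
    have h2 := (b v).toNat_le
    dsimp only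
    omega
  · have h1 := (b u).toNat_le
    have h2 := (b v).toNat_le
    dsimp only at h
    have hcuv : c u = c v := by omega
    have hbuv : b u = b v := by
      rw [hcuv, add_right_inj] at h
      revert h
      cases b u <;> cases b v <;> simp
    have h3 := fun h => hb u (mem_univ u) v (mem_univ v) h hbuv
    rw [SimpleGraph.compl_adj]
    exact ⟨⟨huv, fun h => h3 (Or.inr h)⟩, fun h => h3 (Or.inl ⟨h, hcuv⟩)⟩

/-- The matching on `{0, …, m}` joining `2i` to `2i + 1`. For even `m` it misses only `m`. -/
def pairing (m : ℕ) : SimpleGraph (Fin (m + 1)) where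
  Adj u v := u ≠ v ∧ (u : ℕ) / 2 = (v : ℕ) / 2
  symm := ⟨fun _ _ h => ⟨h.1.symm, h.2.symm⟩⟩
  loopless := ⟨fun _ h => h.1 rfl⟩

lemma pairing_unique {m : ℕ} (x y z : Fin (m + 1)) (hxy : (pairing m).Adj x y)
    (hxz : (pairing m).Adj x z) : y = z := by
  obtain ⟨h1, h2⟩ := hxy
  obtain ⟨h3, h4⟩ := hxz
  rw [Ne, Fin.ext_iff] at h1 h3
  rw [Fin.ext_iff]
  omega

lemma le_degSum_pairing {m : ℕ} (hm : Even m) : m ≤ degSum (pairing m) univ := by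
  have h : ∀ i : Fin m, 1 ≤ degIn (pairing m) univ i.castSucc := by
    intro i
    have hi := i.2
    rw [Nat.even_iff] at hm
    refine degIn_pos.2 ?_
    rcases Nat.mod_two_eq_zero_or_one i with h0 | h0
    · refine ⟨⟨i + 1, by omega⟩, mem_univ _, ?_, ?_⟩
      · simp [Fin.ext_iff]
      · simp only [Fin.val_castSucc]
        omega
    · refine ⟨⟨i - 1, by omega⟩, mem_univ _, ?_, ?_⟩
      · simp only [ne_eq, Fin.ext_iff, Fin.val_castSucc]
        omega
      · simp only [Fin.val_castSucc]
        omega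
  rw [degSum, Fin.sum_univ_castSucc]
  have := card_nsmul_le_sum univ (fun i : Fin m => degIn (pairing m) univ i.castSucc) 1
    fun i _ => h i
  simp only [card_univ, Fintype.card_fin, smul_eq_mul, mul_one] at this
  omega

lemma exists_arrows_degSum_le (k p : ℕ) (hp : 0 < p) :
    ∃ F : SimpleGraph (Fin (k * p + 1)), Arrows F (star k) (clique (p + 1)) ∧
      degSum F univ + deficit k p ≤ k * p * (k * p + 1) := by
  classical
  have hcompl : ∀ M : SimpleGraph (Fin (k * p + 1)),
      degSum Mᶜ univ + degSum M univ = k * p * (k * p + 1) := by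
    intro M
    have := degSum_add_compl Mᶜ univ
    rwa [compl_compl, card_univ, Fintype.card_fin, Nat.add_sub_cancel, mul_comm (k * p + 1)] at this
  by_cases hk : Even k
  · refine ⟨(pairing (k * p))ᶜ, arrows_compl_matching (by simp) hk pairing_unique, ?_⟩
    rw [deficit, if_pos hk, ← hcompl (pairing (k * p))]
    exact Nat.add_le_add_left (le_degSum_pairing (hk.mul_right p)) _
  · have hle : k ≤ #(univ : Finset (Fin (k * p + 1))) := by
      rw [card_univ, Fintype.card_fin]
      nlinarith
    obtain ⟨A, -, hA⟩ := exists_subset_card_eq hle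
    refine ⟨(cliqueOn A)ᶜ, arrows_compl_cliqueOn (by simp) hA, ?_⟩
    have := le_degSum_cliqueOn (A := A)
    rw [hA] at this
    rw [deficit, if_neg hk, ← hcompl (cliqueOn A)]
    exact Nat.add_le_add_left this _

/-- Chvátal's value of the Ramsey number of a star and a clique. -/
lemma ramseyNumber_star_clique (k p : ℕ) (hp : 0 < p) :
    ramseyNumber (star k) (clique (p + 1)) = k * p + 1 := by
  obtain ⟨F, hF, -⟩ := exists_arrows_degSum_le k p hp
  have hmem : Arrows (SimpleGraph.completeGraph (Fin (k * p + 1))) (star k) (clique (p + 1)) :=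
    hF.mono le_top
  refine le_antisymm (Nat.sInf_le hmem) (le_csInf ⟨_, hmem⟩ fun N hN => ?_)
  by_contra! hlt
  refine not_arrows_of_splits (splits_of_card_le ?_) hN
  rw [card_univ, Fintype.card_fin]
  omega

/-- Both size Ramsey numbers are attained by the same graph, on `k * p + 1` vertices. -/
lemma sizeRamseyNumbers_star_clique (hk : 2 ≤ k) (hp : k ^ 3 + k ^ 2 ≤ p) :
    ∃ e, sizeRamseyNumber (star k) (clique (p + 1)) = e ∧
      restrictedSizeRamseyNumber (star k) (clique (p + 1)) = e ∧
      2 * e + deficit k p = k * p * (k * p + 1) := by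
  have hp0 : 0 < p := lt_of_lt_of_le (by positivity) hp
  have hlow : ∀ (N : ℕ) (F : SimpleGraph (Fin N)), Arrows F (star k) (clique (p + 1)) →
      k * p * (k * p + 1) ≤ 2 * F.edgeSet.ncard + deficit k p := by
    intro N F hF
    rw [← degSum_univ]
    exact le_degSum_of_not_splits hk hp fun h => not_arrows_of_splits h hF
  obtain ⟨F, hF, hFe⟩ := exists_arrows_degSum_le k p hp0
  have hFl := hlow _ F hF
  rw [degSum_univ] at hFe
  refine ⟨F.edgeSet.ncard, ?_, ?_, by omega⟩
  · refine le_antisymm (Nat.sInf_le ⟨_, F, hF, rfl⟩) (le_csInf ⟨_, _, F, hF, rfl⟩ ?_)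
    rintro m ⟨N, F', hF', rfl⟩
    have := hlow _ F' hF'
    omega
  · unfold restrictedSizeRamseyNumber
    rw [ramseyNumber_star_clique k p hp0]
    refine le_antisymm (Nat.sInf_le ⟨F, hF, rfl⟩) (le_csInf ⟨_, F, hF, rfl⟩ ?_)
    rintro m ⟨F', hF', rfl⟩
    have := hlow _ F' hF'
    omega

end Extremal

end SizeRamsey

theorem theorem3 (k n : ℕ) (hk : 2 ≤ k) (hn : k ^ 3 + 2 * k ^ 2 + 2 * k ≤ n) :
    SizeRamsey.sizeRamseyNumber (SizeRamsey.star k) (SizeRamsey.clique n) =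
        SizeRamsey.restrictedSizeRamseyNumber (SizeRamsey.star k) (SizeRamsey.clique n) ∧
      (Odd k →
        (SizeRamsey.restrictedSizeRamseyNumber (SizeRamsey.star k) (SizeRamsey.clique n) : ℚ) =
          ((k * (n - 1) + 1).choose 2 : ℚ) - (k.choose 2 : ℚ)) ∧
      (Even k →
        (SizeRamsey.restrictedSizeRamseyNumber (SizeRamsey.star k) (SizeRamsey.clique n) : ℚ) =
          ((k * (n - 1) + 1).choose 2 : ℚ) - (k : ℚ) * ((n : ℚ) - 1) / 2) := by
  obtain ⟨p, rfl⟩ : ∃ p, n = p + 1 := ⟨n - 1, by omega⟩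
  have hp : k ^ 3 + k ^ 2 ≤ p := by nlinarith
  obtain ⟨e, h1, h2, he⟩ := SizeRamsey.sizeRamseyNumbers_star_clique hk hp
  refine ⟨h1.trans h2.symm, fun hodd => ?_, fun heven => ?_⟩
  · rw [SizeRamsey.deficit, if_neg (Nat.not_even_iff_odd.2 hodd)] at he
    have he' : (2 * e + k * (k - 1) : ℚ) = k * p * (k * p + 1) := by
      rw [← Nat.cast_pred (show 0 < k by omega)]
      exact_mod_cast he
    rw [h2, Nat.add_sub_cancel, Nat.cast_choose_two, Nat.cast_choose_two]
    push_cast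
    linarith
  · rw [SizeRamsey.deficit, if_pos heven] at he
    have he' : (2 * e + k * p : ℚ) = k * p * (k * p + 1) := by exact_mod_cast he
    rw [h2, Nat.add_sub_cancel, Nat.cast_choose_two]
    push_cast
    linarith
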